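/- Let $1\le S\le N$, let $\mathcal X_S\subseteq\mathbb R^N$ be the set of vectors with at most $S$ nonzero entries, let $H\in\mathbb R^{M\times N}$ satisfy $\operatorname{spark}(H)>S$ (any set of at most $S$ columns of $H$ is linearly independent), and let $\sigma>0$. For $x\in\mathbb R^N$ let $y\sim\mathcal N(Hx,\sigma^2 I)$ on $\mathbb R^M$, with density $f_H(y;x)=(2\pi\sigma^2)^{-M/2}\exp\bigl(-\tfrac1{2\sigma^2}\|y-Hx\|_2^2\bigr)$ and expectation $\mathsf E_x$. Let $D=\operatorname{rank}H$, let $H=U\Sigma V^T$ be a thin singular value decomposition ($U^TU=I$, $V^TV=I$, $\Sigma\in\mathbb R^{D\times D}$ diagonal with positive diagonal), and put $\widetilde H=V\Sigma^{-1}$, with Moore–Penrose pseudoinverse $\widetilde H^\dagger$. For multi-indices $p\in\mathbb Z_+^D$ write $p!=\prod_l p_l!$ and $z^p=\prod_l z_l^{p_l}$. Let $g,c:\mathcal X_S\to\mathbb R$, $\gamma=c+g$, and $x_0\in\mathcal X_S$. Let $\mathcal A(c,x_0)$ be the set of estimators $\hat g:\mathbb R^M\to\mathbb R$ with finite variance $v(\hat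 g;x_0)$ under $f_H(\cdot;x_0)$ and with $\mathsf E_x\{\hat g(y)\}-g(x)=c(x)$ for all $x\in\mathcal X_S$. Let $M_{\mathrm{SLGM}}(c,x_0)=\inf_{\hat g\in\mathcal A(c,x_0)}v(\hat g;x_0)$; an LMV estimator is an element of $\mathcal A(c,x_0)$ that attains this infimum. Let $\mathcal C(c)\subseteq\ell^2(\mathbb Z_+^D)$ be the set of those $a\in\ell^2(\mathbb Z_+^D)$ for which $$c(x)=\exp\Bigl(\tfrac1{2\sigma^2}\|Hx_0\|_2^2-\tfrac1{\sigma^2}x^TH^THx_0\Bigr)\sum_{p\in\mathbb Z_+^D}\frac{a[p]}{\sqrt{p!}}\Bigl(\tfrac1\sigma\widetilde H^\dagger x\Bigr)^p-g(x)\qquad\text{for all }x\in\mathcal X_S .$$ Suppose that $c$ is valid at $x_0$, i.e. $\mathcal A(c,x_0)\neq\emptyset$. Then: 1. The minimum of $\|a\|^2_{\ell^2}$ over $a\in\mathcal C(c)$ is attained, and $M_{\mathrm{SLGM}}(c,x_0)=\min_{a\in\mathcal C(c)}\|a\|^2_{\ell^2}-\gamma^2(x_0)$. 2. For every $a\in\mathcal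 C(c)$, the series $$\hat g(y)=\exp\Bigl(-\tfrac1{2\sigma^2}\|Hx_0\|_2^2\Bigr)\sum_{p\in\mathbb Z_+^D}\frac{a[p]}{\sqrt{p!}}\,\chi_p(y),\qquad \chi_p(y)=\frac{\partial^p}{\partial z^p}\Bigl[\frac{f_H(y;\sigma\widetilde Hz)}{f_H(y;x_0)}\exp\bigl(\tfrac1\sigma x_0^TH^TH\widetilde Hz\bigr)\Bigr]\Big|_{z=0},$$ converges unconditionally in mean square under $f_H(\cdot;x_0)$, and its sum $\hat g$ belongs to $\mathcal A(c,x_0)$. 3. There is exactly one $a_0\in\mathcal C(c)$ of minimum norm, and an estimator is an LMV estimator at $x_0$ for $c$ if and only if it is (almost everywhere) the estimator of part 2 with $a=a_0$. -/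

import Mathlib

open MeasureTheory Matrix Filter Topology
open scoped ENNReal

noncomputable section

namespace SLGM

/-! ### Vectors, matrices and multi-indices -/

/-- The number `‖x‖₀` of nonzero entries of a vector. -/
def l0 {N : ℕ} (x : Fin N → ℝ) : ℕ := {i : Fin N | x i ≠ 0}.ncard

/-- The set `𝒳_S` of `S`-sparse vectors of `ℝ^N`. -/
def sparseSet (N S : ℕ) : Set (Fin N → ℝ) := {x | l0 x ≤ S}

/-- The squared Euclidean norm `‖v‖₂²`. -/
def sqNorm {n : ℕ} (v : Fin n → ℝ) : ℝ := ∑ i, v i ^ 2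

/-- The spark of a matrix: the minimum number of linearly dependent columns
(`⊤` if all columns together are linearly independent). -/
def spark {M N : ℕ} (H : Matrix (Fin M) (Fin N) ℝ) : ℕ∞ :=
  ⨅ (I : Finset (Fin N)) (_ : ¬ LinearIndependent ℝ (fun j : I => H.col (j : Fin N))),
    (I.card : ℕ∞)

/-- The four Penrose equations for real matrices. -/
structure IsMoorePenrose {m n : ℕ} (A : Matrix (Fin m) (Fin n) ℝ)
    (B : Matrix (Fin n) (Fin m) ℝ) : Prop where
  mul_mul_left : A * B * A = A
  mul_mul_right : B * A * B = B
  symm_left : (A * B)ᵀ = A * B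
  symm_right : (B * A)ᵀ = B * A

theorem IsMoorePenrose.unique {m n : ℕ} {A : Matrix (Fin m) (Fin n) ℝ}
    {B C : Matrix (Fin n) (Fin m) ℝ} (hB : IsMoorePenrose A B) (hC : IsMoorePenrose A C) :
    B = C := by
  have h1 : A * B = A * C := by
    calc A * B = (A * B)ᵀ := hB.symm_left.symm
      _ = ((A * C) * (A * B))ᵀ := by rw [← Matrix.mul_assoc (A * C), hC.mul_mul_left]
      _ = (A * B)ᵀ * (A * C)ᵀ := Matrix.transpose_mul _ _
      _ = (A * B) * (A * C) := by rw [hB.symm_left, hC.symm_left]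
      _ = A * C := by rw [← Matrix.mul_assoc (A * B), hB.mul_mul_left]
  have h2 : B * A = C * A := by
    calc B * A = (B * A)ᵀ := hB.symm_right.symm
      _ = ((B * A) * (C * A))ᵀ := by
          rw [Matrix.mul_assoc B A, ← Matrix.mul_assoc A C, hC.mul_mul_left]
      _ = (C * A)ᵀ * (B * A)ᵀ := Matrix.transpose_mul _ _
      _ = (C * A) * (B * A) := by rw [hB.symm_right, hC.symm_right]
      _ = C * A := by rw [Matrix.mul_assoc C A, ← Matrix.mul_assoc A B, hB.mul_mul_left]
  calc B = B * A * B := hB.mul_mul_right.symm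
    _ = C * A * C := by rw [h2, Matrix.mul_assoc, h1, ← Matrix.mul_assoc]
    _ = C := hC.mul_mul_right

/-- The Moore-Penrose pseudoinverse `A†` of a real matrix. -/
def pinv {m n : ℕ} (A : Matrix (Fin m) (Fin n) ℝ) : Matrix (Fin n) (Fin m) ℝ :=
  Classical.epsilon (IsMoorePenrose A)

theorem pinv_eq {m n : ℕ} {A : Matrix (Fin m) (Fin n) ℝ} {B : Matrix (Fin n) (Fin m) ℝ}
    (h : IsMoorePenrose A B) : pinv A = B :=
  (Classical.epsilon_spec ⟨B, h⟩ : IsMoorePenrose A (pinv A)).unique h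

/-- A thin singular value decomposition `H = U Σ Vᵀ`, with `D = rank H`, `Uᵀ U = I`, `Vᵀ V = I`
and `Σ` diagonal with positive diagonal entries `s`. -/
structure ThinSVD {M N : ℕ} (H : Matrix (Fin M) (Fin N) ℝ) where
  U : Matrix (Fin M) (Fin H.rank) ℝ
  s : Fin H.rank → ℝ
  V : Matrix (Fin N) (Fin H.rank) ℝ
  U_orth : Uᵀ * U = 1
  V_orth : Vᵀ * V = 1
  s_pos : ∀ k, 0 < s k
  eq_mul : H = U * Matrix.diagonal s * Vᵀ

/-- The matrix `H̃ = V Σ⁻¹`. -/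
def ThinSVD.Htilde {M N : ℕ} {H : Matrix (Fin M) (Fin N) ℝ} (d : ThinSVD H) :
    Matrix (Fin N) (Fin H.rank) ℝ :=
  d.V * (Matrix.diagonal d.s)⁻¹

theorem ThinSVD.diag_mul_inv {M N : ℕ} {H : Matrix (Fin M) (Fin N) ℝ} (d : ThinSVD H) :
    Matrix.diagonal d.s * (Matrix.diagonal d.s)⁻¹ = 1 := by
  apply Matrix.mul_nonsing_inv
  rw [Matrix.det_diagonal]
  exact (Finset.prod_ne_zero_iff.mpr fun k _ => (d.s_pos k).ne').isUnit

theorem ThinSVD.inv_mul_diag {M N : ℕ} {H : Matrix (Fin M) (Fin N) ℝ} (d : ThinSVD H) :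
    (Matrix.diagonal d.s)⁻¹ * Matrix.diagonal d.s = 1 :=
  mul_eq_one_comm.mp d.diag_mul_inv

/-- The pseudoinverse of `H̃` exists and equals `Σ Vᵀ`. -/
theorem ThinSVD.isMoorePenrose_Htilde {M N : ℕ} {H : Matrix (Fin M) (Fin N) ℝ}
    (d : ThinSVD H) : IsMoorePenrose d.Htilde (Matrix.diagonal d.s * d.Vᵀ) := by
  have h1 : d.Htilde * (Matrix.diagonal d.s * d.Vᵀ) = d.V * d.Vᵀ := by
    rw [ThinSVD.Htilde, Matrix.mul_assoc, ← Matrix.mul_assoc _ (Matrix.diagonal d.s),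
      d.inv_mul_diag, Matrix.one_mul]
  have h2 : Matrix.diagonal d.s * d.Vᵀ * d.Htilde = 1 := by
    rw [ThinSVD.Htilde, Matrix.mul_assoc, ← Matrix.mul_assoc d.Vᵀ, d.V_orth, Matrix.one_mul,
      d.diag_mul_inv]
  refine ⟨?_, ?_, ?_, ?_⟩
  · rw [Matrix.mul_assoc, h2, Matrix.mul_one]
  · rw [h2, Matrix.one_mul]
  · rw [h1, Matrix.transpose_mul, Matrix.transpose_transpose]
  · rw [h2, Matrix.transpose_one]

theorem ThinSVD.pinv_Htilde {M N : ℕ} {H : Matrix (Fin M) (Fin N) ℝ} (d : ThinSVD H) :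
    pinv d.Htilde = Matrix.diagonal d.s * d.Vᵀ :=
  pinv_eq d.isMoorePenrose_Htilde

/-- The factorial `p! = ∏ p_l!` of a multi-index. -/
def mfact {D : ℕ} (p : Fin D → ℕ) : ℝ := ∏ l, ((p l).factorial : ℝ)

/-- The monomial `z^p = ∏ z_l^{p_l}`. -/
def mpow {D : ℕ} (z : Fin D → ℝ) (p : Fin D → ℕ) : ℝ := ∏ l, z l ^ p l

/-- The partial derivative `∂f/∂z_l`. -/
def partialDeriv {D : ℕ} (l : Fin D) (f : (Fin D → ℝ) → ℝ) : (Fin D → ℝ) → ℝ :=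
  fun z => lineDeriv ℝ f z (Pi.single l 1)

/-- The higher partial derivative `∂^p f / ∂z^p` for a multi-index `p`. -/
def mixedDeriv {D : ℕ} (p : Fin D → ℕ) (f : (Fin D → ℝ) → ℝ) : (Fin D → ℝ) → ℝ :=
  (List.finRange D).foldr (fun l h => (partialDeriv l)^[p l] h) f

/-- The space `ℓ²(ℤ₊^D)` of square-summable real sequences indexed by multi-indices;
its norm satisfies `‖a‖² = ∑ a[p]²`. -/
abbrev ell2 (D : ℕ) : Type := lp (fun _ : Fin D → ℕ => ℝ) 2

/-! ### The statistical model -/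

/-- The Gaussian density `f_H(y; x)` of the observation `y = H x + n`, `n ∼ 𝒩(0, σ² I)`. -/
def pdf {M N : ℕ} (H : Matrix (Fin M) (Fin N) ℝ) (σ : ℝ) (y : Fin M → ℝ) (x : Fin N → ℝ) : ℝ :=
  1 / (2 * Real.pi * σ ^ 2) ^ ((M : ℝ) / 2) *
    Real.exp (-(1 / (2 * σ ^ 2)) * sqNorm (y - H *ᵥ x))

/-- The law of the observation for the parameter vector `x`. -/
def law {M N : ℕ} (H : Matrix (Fin M) (Fin N) ℝ) (σ : ℝ) (x : Fin N → ℝ) :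
    Measure (Fin M → ℝ) :=
  volume.withDensity fun y => ENNReal.ofReal (pdf H σ y x)

/-- The likelihood ratio `ρ_{x₀}(y, x) = f_H(y; x) / f_H(y; x₀)`. -/
def likelihoodRatio {M N : ℕ} (H : Matrix (Fin M) (Fin N) ℝ) (σ : ℝ) (x₀ : Fin N → ℝ)
    (y : Fin M → ℝ) (x : Fin N → ℝ) : ℝ :=
  pdf H σ y x / pdf H σ y x₀

/-! ### Minimum variance estimation -/

/-- The variance `v(ĝ; x)` of an estimator at `x`, in `[0, ∞]`. -/
def variance {M N : ℕ} (H : Matrix (Fin M) (Fin N) ℝ) (σ : ℝ) (ghat : (Fin M → ℝ) → ℝ)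
    (x : Fin N → ℝ) : ℝ≥0∞ :=
  ProbabilityTheory.evariance ghat (law H σ x)

/-- The set `𝒜(c, x₀)` of allowed estimators: the estimators with finite variance at `x₀` whose
mean exists and whose bias equals `c` at all `x ∈ 𝒳_S`. (Integrability contains measurability
with respect to the completed Lebesgue measure.) -/
def allowed {M N : ℕ} (H : Matrix (Fin M) (Fin N) ℝ) (σ : ℝ) (S : ℕ)
    (g c : sparseSet N S → ℝ) (x₀ : sparseSet N S) : Set ((Fin M → ℝ) → ℝ) :=
  {ghat | variance H σ ghat x₀ < ⊤ ∧
    ∀ x : sparseSet N S, Integrable ghat (law H σ x) ∧ (∫ y, ghat y ∂(law H σ x)) - g x = c x}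

/-- The bias function `c` is valid at `x₀`. -/
def IsValid {M N : ℕ} (H : Matrix (Fin M) (Fin N) ℝ) (σ : ℝ) (S : ℕ)
    (g c : sparseSet N S → ℝ) (x₀ : sparseSet N S) : Prop :=
  (allowed H σ S g c x₀).Nonempty

/-- The minimum achievable variance (Barankin bound) `M_SLGM(c, x₀)`; it is `∞` if `c` is not
valid. -/
def minVariance {M N : ℕ} (H : Matrix (Fin M) (Fin N) ℝ) (σ : ℝ) (S : ℕ)
    (g c : sparseSet N S → ℝ) (x₀ : sparseSet N S) : ℝ≥0∞ :=
  ⨅ ghat ∈ allowed H σ S g c x₀, variance H σ ghat x₀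

/-- `ĝ` is a locally minimum variance (LMV) estimator at `x₀` for the bias function `c`. -/
def IsLMV {M N : ℕ} (H : Matrix (Fin M) (Fin N) ℝ) (σ : ℝ) (S : ℕ)
    (g c : sparseSet N S → ℝ) (x₀ : sparseSet N S) (ghat : (Fin M → ℝ) → ℝ) : Prop :=
  ghat ∈ allowed H σ S g c x₀ ∧ variance H σ ghat x₀ = minVariance H σ S g c x₀

/-! ### Coefficient sequences and the series estimator -/

/-- The set `𝒞(c)` of the sequences `a ∈ ℓ²(ℤ₊^D)` with
`c(x) = exp(‖H x₀‖²/(2σ²) - xᵀHᵀH x₀/σ²) ∑_p a[p]/√p! (H̃† x/σ)^p - g(x)` on `𝒳_S`. -/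
def coeffSet {M N : ℕ} {H : Matrix (Fin M) (Fin N) ℝ} (d : ThinSVD H) (σ : ℝ) (S : ℕ)
    (g c : sparseSet N S → ℝ) (x₀ : sparseSet N S) : Set (ell2 H.rank) :=
  {a | ∀ x : sparseSet N S,
    Summable (fun p : Fin H.rank → ℕ =>
      a p / √(mfact p) * mpow ((1 / σ) • (pinv d.Htilde *ᵥ (x : Fin N → ℝ))) p) ∧
    c x = Real.exp (1 / (2 * σ ^ 2) * sqNorm (H *ᵥ (x₀ : Fin N → ℝ))
          - 1 / σ ^ 2 * ((x : Fin N → ℝ) ⬝ᵥ (Hᵀ * H) *ᵥ (x₀ : Fin N → ℝ)))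
        * (∑' p : Fin H.rank → ℕ,
            a p / √(mfact p) * mpow ((1 / σ) • (pinv d.Htilde *ᵥ (x : Fin N → ℝ))) p)
        - g x}

/-- The function `χ_p(y) = ∂^p [ρ_{x₀}(y, σ H̃ z) exp(x₀ᵀHᵀH H̃ z / σ)] / ∂z^p` at `z = 0`. -/
def chi {M N : ℕ} {H : Matrix (Fin M) (Fin N) ℝ} (d : ThinSVD H) (σ : ℝ) (x₀ : Fin N → ℝ)
    (p : Fin H.rank → ℕ) (y : Fin M → ℝ) : ℝ :=
  mixedDeriv p (fun z : Fin H.rank → ℝ =>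
    likelihoodRatio H σ x₀ y (σ • (d.Htilde *ᵥ z)) *
      Real.exp (1 / σ * (x₀ ⬝ᵥ (Hᵀ * H * d.Htilde) *ᵥ z))) 0

/-- The partial sum of `exp(-‖H x₀‖²/(2σ²)) ∑_p a[p]/√p! χ_p(y)` over a finite set of
multi-indices. -/
def partialSum {M N : ℕ} {H : Matrix (Fin M) (Fin N) ℝ} (d : ThinSVD H) (σ : ℝ)
    (x₀ : Fin N → ℝ) (a : ell2 H.rank) (F : Finset (Fin H.rank → ℕ)) (y : Fin M → ℝ) : ℝ :=
  Real.exp (-(1 / (2 * σ ^ 2)) * sqNorm (H *ᵥ x₀)) *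
    ∑ p ∈ F, a p / √(mfact p) * chi d σ x₀ p y

/-- `ĝ(y) = exp(-‖H x₀‖²/(2σ²)) ∑_p a[p]/√p! χ_p(y)` as random variables: the series converges
to `ĝ` unconditionally in mean square under the law of the observation for `x₀`. -/
def IsSeriesEstimator {M N : ℕ} {H : Matrix (Fin M) (Fin N) ℝ} (d : ThinSVD H) (σ : ℝ)
    (x₀ : Fin N → ℝ) (a : ell2 H.rank) (ghat : (Fin M → ℝ) → ℝ) : Prop :=
  AEStronglyMeasurable ghat (law H σ x₀) ∧
    Tendsto (fun F : Finset (Fin H.rank → ℕ) =>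
      eLpNorm (fun y => ghat y - partialSum d σ x₀ a F y) 2 (law H σ x₀)) atTop (𝓝 0)

end SLGM

end

/-! Put z = H̃†x/σ, s = H̃†x₀/σ and w = Uᵀ(y − Hx₀)/σ. Since Hx = σUz, the likelihood ratio ρ_x =
f_H(·;x)/f_H(·;x₀) is the product over coordinates of exp(w(z−s) − (z−s)²/2) (`likelihoodRatio_eq`),
and w is standard Gaussian under the law at x₀ (`measurePreserving_redObs`). In L² of that law E_x ĝ
= ⟨ĝ, ρ_x⟩, so the allowed estimators are the solutions of the linear system ⟨ĝ, ρ_x⟩ = γ(x)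
(`mem_allowed_iff`). Their variance at x₀ is ‖ĝ‖² − γ(x₀)², so an LMV estimator is a solution of
least norm.

Up to normalisation the terms of the series are products of exp(−s² − ws) He_n(w + 2s)/√n!. These
form an orthonormal family whose inner products with ρ_x are the weighted monomials defining 𝒞(c).
Hence 𝒞(c) is the solution set of ⟨a, coefficients of ρ_x⟩ = γ(x) in ℓ² (`mem_coeffSet_iff`).
Parseval's identity puts every ρ_x in the closed span of the family (`synth_coeffs_ratioVec`).

Therefore synthesis maps 𝒞(c) isometrically into the allowed estimators. Taking coefficients maps
these back into 𝒞(c) without increasing the norm, and preserves it only on the closed span. The two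
minimisation problems have the same value, and the minimiser in 𝒞(c) exists and is unique by
orthogonal projection (`exists_minimal_solution`). -/

noncomputable section

namespace SLGM

/-! ### Orthonormal families and their coefficient sequences -/

section Hilbert

variable {ι E : Type*} [NormedAddCommGroup E] [InnerProductSpace ℝ E] [CompleteSpace E]

local notation "ℓ²" ι => lp (fun _ : ι => ℝ) 2

/-- The isometry `a ↦ ∑ a_i e_i` of an orthonormal family. -/
def synth {e : ι → E} (he : Orthonormal ℝ e) : (ℓ² ι) →ₗᵢ[ℝ] E :=
  he.orthogonalFamily.linearIsometry

theorem hasSum_synth {e : ι → E} (he : Orthonormal ℝ e) (a : ℓ² ι) :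
    HasSum (fun i => a i • e i) (synth he a) := by
  have h := he.orthogonalFamily.hasSum_linearIsometry a
  simp only [LinearIsometry.toSpanSingleton_apply] at h
  exact h

/-- The sequence of coefficients of a vector with respect to an orthonormal family. -/
def coeffs {e : ι → E} (he : Orthonormal ℝ e) (x : E) : ℓ² ι :=
  (ContinuousLinearMap.adjoint (synth he).toContinuousLinearMap) x

theorem inner_coeffs {e : ι → E} (he : Orthonormal ℝ e) (a : ℓ² ι) (x : E) :
    inner ℝ a (coeffs he x) = inner ℝ (synth he a) x :=
  ContinuousLinearMap.adjoint_inner_right _ _ _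

theorem coeffs_apply {e : ι → E} (he : Orthonormal ℝ e) (x : E) (i : ι) :
    coeffs he x i = inner ℝ (e i) x := by
  classical
  have h := inner_coeffs he (lp.single 2 i 1) x
  rw [lp.inner_single_left] at h
  have h2 : synth he (lp.single 2 i 1) = e i := by
    exact (he.orthogonalFamily.linearIsometry_apply_single (i := i) (1 : ℝ)).trans (by simp)
  rw [h2] at h
  simpa using h

/-- Pythagoras: `synth he (coeffs he x)` is the orthogonal projection of `x` onto the closed span of
the family. -/
theorem norm_sq_sub_synth_coeffs {e : ι → E} (he : Orthonormal ℝ e) (x : E) :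
    ‖x - synth he (coeffs he x)‖ ^ 2 = ‖x‖ ^ 2 - ‖coeffs he x‖ ^ 2 := by
  rw [norm_sub_sq_real, real_inner_comm, ← inner_coeffs, real_inner_self_eq_norm_sq,
    (synth he).norm_map]
  ring

theorem norm_coeffs_le {e : ι → E} (he : Orthonormal ℝ e) (x : E) : ‖coeffs he x‖ ≤ ‖x‖ := by
  have h := norm_sq_sub_synth_coeffs he x
  exact abs_le_of_sq_le_sq' (by nlinarith [sq_nonneg ‖x - synth he (coeffs he x)‖])
    (norm_nonneg _) |>.2

/-- The equality case of Bessel's inequality; it yields the uniqueness of the LMV estimator. -/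
theorem synth_coeffs_of_norm_le {e : ι → E} (he : Orthonormal ℝ e) {x : E}
    (h : ‖x‖ ≤ ‖coeffs he x‖) : synth he (coeffs he x) = x := by
  have h1 := norm_sq_sub_synth_coeffs he x
  rw [le_antisymm h (norm_coeffs_le he x), sub_self] at h1
  exact (sub_eq_zero.mp (norm_eq_zero.mp (pow_eq_zero_iff two_ne_zero |>.mp h1))).symm

theorem ell2_norm_sq (a : ℓ² ι) : HasSum (fun i => a i ^ 2) (‖a‖ ^ 2) := by
  have := lp.hasSum_inner (𝕜 := ℝ) a a
  rw [real_inner_self_eq_norm_sq] at this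
  simpa [sq] using this

/-- Parseval's identity characterises the vectors spanned by an orthonormal family. -/
theorem synth_coeffs_of_hasSum {e : ι → E} (he : Orthonormal ℝ e) {x : E}
    (h : HasSum (fun i => inner ℝ (e i) x ^ 2) (‖x‖ ^ 2)) : synth he (coeffs he x) = x := by
  have h1 := ell2_norm_sq (coeffs he x)
  simp_rw [coeffs_apply] at h1
  have h2 := h1.unique h
  refine synth_coeffs_of_norm_le he (le_of_eq ?_)
  exact ((sq_eq_sq₀ (norm_nonneg _) (norm_nonneg _)).mp h2).symm

/-- A consistent system of linear equations in a Hilbert space has a solution such that every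
solution decomposes orthogonally into it and a remainder. -/
theorem exists_minimal_solution {κ : Type*} (r : κ → E) (γ : κ → ℝ) {a₁ : E}
    (h₁ : ∀ k, inner ℝ a₁ (r k) = γ k) :
    ∃ a₀ : E, (∀ k, inner ℝ a₀ (r k) = γ k) ∧
      ∀ a, (∀ k, inner ℝ a (r k) = γ k) → ‖a‖ ^ 2 = ‖a₀‖ ^ 2 + ‖a - a₀‖ ^ 2 := by
  -- Projecting one solution onto the closed span of the `r k` gives the minimiser: any other
  -- solution differs from it by a vector orthogonal to every `r k`, hence to `K`.
  let K := (Submodule.span ℝ (Set.range r)).topologicalClosure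
  have hK : IsClosed (K : Set E) := Submodule.isClosed_topologicalClosure _
  have : CompleteSpace K := hK.completeSpace_coe
  have hr : ∀ k, r k ∈ K := fun k =>
    Submodule.le_topologicalClosure _ (Submodule.subset_span ⟨k, rfl⟩)
  have h0 : ∀ k, inner ℝ (K.starProjection a₁) (r k) = γ k := fun k => by
    rw [← h₁ k]
    have := K.starProjection_inner_eq_zero a₁ (r k) (hr k)
    rw [inner_sub_left] at this
    linarith
  refine ⟨K.starProjection a₁, h0, fun a ha => ?_⟩
  have horth : inner ℝ (a - K.starProjection a₁) (K.starProjection a₁) = 0 := by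
    have hle : K ≤ (ℝ ∙ (a - K.starProjection a₁))ᗮ := by
      refine Submodule.topologicalClosure_minimal _ ?_ (Submodule.isClosed_orthogonal _)
      rw [Submodule.span_le]
      rintro _ ⟨k, rfl⟩
      rw [SetLike.mem_coe, Submodule.mem_orthogonal_singleton_iff_inner_right, inner_sub_left,
        ha, h0, sub_self]
    exact Submodule.mem_orthogonal_singleton_iff_inner_right.mp
      (hle (K.starProjection_apply_mem a₁))
  have : a = K.starProjection a₁ + (a - K.starProjection a₁) := by abel
  conv_lhs => rw [this]
  rw [norm_add_sq_real, real_inner_comm, horth]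
  ring

end Hilbert

/-! ### Sums over multi-indices -/

/-- Nonnegativity makes the double family summable, so one coordinate can be split off at a time. -/
theorem hasSum_prod_multiindex {D : ℕ} (f : Fin D → ℕ → ℝ) (A : Fin D → ℝ)
    (h0 : ∀ l n, 0 ≤ f l n) (h : ∀ l, HasSum (f l) (A l)) :
    HasSum (fun p : Fin D → ℕ => ∏ l, f l (p l)) (∏ l, A l) := by
  induction D with
  | zero => simp
  | succ D ih =>
    have h1 := ih (fun l => f l.succ) (fun l => A l.succ) (fun l => h0 l.succ) (fun l => h l.succ)
    have hs := (h 0).summable.mul_of_nonneg h1.summable (h0 0)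
      (fun p => Finset.prod_nonneg fun l _ => h0 _ _)
    have h2 := (h 0).mul h1 hs
    rw [Fin.prod_univ_succ, ← (Fin.consEquiv fun _ : Fin (D + 1) => ℕ).hasSum_iff]
    have e : (fun p : Fin (D + 1) → ℕ => ∏ l, f l (p l)) ∘ (Fin.consEquiv fun _ => ℕ) =
        fun x => f 0 x.1 * ∏ l, f l.succ (x.2 l) := by
      funext p
      simp only [Function.comp_apply, Fin.prod_univ_succ, Fin.consEquiv_apply, Fin.cons_zero,
        Fin.cons_succ]
    rw [e]
    exact h2

open ProbabilityTheory Polynomial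

/-! ### Hermite polynomials and the standard Gaussian measure on the line -/

/-- The standard Gaussian measure on `ℝ`. -/
abbrev stdGauss : Measure ℝ := gaussianReal 0 1

/-- The real Hermite polynomial of degree `n`. -/
def hermiteR (n : ℕ) : ℝ[X] := (hermite n).map (Int.castRingHom ℝ)

theorem hermiteR_zero : hermiteR 0 = 1 := by simp [hermiteR]

theorem hermiteR_succ (n : ℕ) : hermiteR (n + 1) = X * hermiteR n - derivative (hermiteR n) := by
  simp [hermiteR, hermite_succ]

theorem hermiteR_eval (n : ℕ) (x : ℝ) : (hermiteR n).eval x = aeval x (hermite n) := by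
  simp [hermiteR, aeval_def, eval_map]

theorem integrable_poly_mul_exp (q : ℝ[X]) (t : ℝ) :
    Integrable (fun x => q.eval x * Real.exp (t * x)) stdGauss := by
  induction q using Polynomial.induction_on' with
  | add p q hp hq =>
    simp only [eval_add, add_mul]
    exact hp.add hq
  | monomial n a =>
    have h : Integrable (fun x : ℝ => x ^ n * Real.exp (t * x)) stdGauss :=
      integrable_pow_mul_exp_of_mem_interior_integrableExpSet (X := fun x : ℝ => x)
        (by simp [integrableExpSet_fun_id_gaussianReal]) n
    simpa [mul_assoc] using h.const_mul a

theorem integrable_poly (q : ℝ[X]) : Integrable (fun x => q.eval x) stdGauss := by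
  simpa using integrable_poly_mul_exp q 0

theorem eval_derivative_add (q : ℝ[X]) (t x : ℝ) :
    (derivative q + (C t - X) * q).eval x = (derivative q).eval x + (t - x) * q.eval x := by
  rw [eval_add, eval_mul, eval_sub, eval_C, eval_X]

theorem integrable_stdGauss_iff {f : ℝ → ℝ} :
    Integrable f stdGauss ↔ Integrable (fun x => gaussianPDFReal 0 1 x * f x) volume := by
  rw [stdGauss, gaussianReal_of_var_ne_zero 0 one_ne_zero,
    integrable_withDensity_iff_integrable_smul' (measurable_gaussianPDF 0 1)
      (ae_of_all _ fun _ => gaussianPDF_lt_top)]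
  simp [toReal_gaussianPDF]

theorem hasDerivAt_gaussianPDFReal (x : ℝ) :
    HasDerivAt (gaussianPDFReal 0 1) (-x * gaussianPDFReal 0 1 x) x := by
  unfold gaussianPDFReal
  have h : HasDerivAt (fun x : ℝ => -(x - 0) ^ 2 / (2 * ((1 : NNReal) : ℝ))) (-x) x := by
    have := (((hasDerivAt_id x).sub_const 0).pow 2).neg.div_const (2 * ((1 : NNReal) : ℝ))
    refine this.congr_deriv ?_
    simp
    ring
  refine (h.exp.const_mul _).congr_deriv ?_
  ring

/-- Gaussian integration by parts. -/
theorem integral_gaussian_parts (q : ℝ[X]) (t : ℝ) :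
    ∫ x, ((derivative q).eval x + (t - x) * q.eval x) * Real.exp (t * x) ∂stdGauss = 0 := by
  have hI : Integrable (fun x => ((derivative q).eval x + (t - x) * q.eval x) *
      Real.exp (t * x)) stdGauss := by
    exact (integrable_poly_mul_exp (derivative q + (C t - X) * q) t).congr
      (ae_of_all _ fun x => congrArg (· * _) (eval_derivative_add q t x))
  rw [integral_gaussianReal_eq_integral_smul one_ne_zero]
  -- Times the Gaussian density, the integrand is the derivative of density · q · exp(tx), which is
  -- integrable together with that derivative.
  refine integral_eq_zero_of_hasDerivAt_of_integrable
    (f := fun x => gaussianPDFReal 0 1 x * (q.eval x * Real.exp (t * x))) (fun x => ?_)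
    (integrable_stdGauss_iff.mp hI) (integrable_stdGauss_iff.mp (integrable_poly_mul_exp q t))
  have he : HasDerivAt (fun x : ℝ => Real.exp (t * x)) (Real.exp (t * x) * t) x := by
    simpa using ((hasDerivAt_id x).const_mul t).exp
  refine ((hasDerivAt_gaussianPDFReal x).mul ((q.hasDerivAt x).mul he)).congr_deriv ?_
  simp only [Pi.mul_apply, smul_eq_mul]
  ring

/-- By He_{n+1} = X He_n − He_n', each step multiplies the integral by t, up to a term that vanishes
by parts. -/
theorem integral_hermite_mul_exp (n : ℕ) (t : ℝ) :
    ∫ x, (hermiteR n).eval x * Real.exp (t * x) ∂stdGauss = t ^ n * Real.exp (t ^ 2 / 2) := by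
  induction n with
  | zero =>
    have := congrFun (mgf_fun_id_gaussianReal (μ := 0) (v := 1)) t
    simpa [mgf, hermiteR_zero] using this
  | succ n ih =>
    have h := integral_gaussian_parts (hermiteR n) t
    have h2 : ∀ x : ℝ, (hermiteR (n + 1)).eval x * Real.exp (t * x) =
        t * ((hermiteR n).eval x * Real.exp (t * x)) -
        ((derivative (hermiteR n)).eval x + (t - x) * (hermiteR n).eval x) * Real.exp (t * x) := by
      intro x
      rw [hermiteR_succ]
      simp only [eval_sub, eval_mul, eval_X]
      ring
    simp_rw [h2]
    rw [integral_sub ((integrable_poly_mul_exp _ t).const_mul t), h, integral_const_mul, ih]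
    · ring
    · exact (integrable_poly_mul_exp (derivative (hermiteR n) + (C t - X) * hermiteR n) t).congr
        (ae_of_all _ fun x => congrArg (· * _) (eval_derivative_add _ t x))

/-- The operator X − d/dx generating the Hermite polynomials is adjoint to d/dx in Gaussian L², so
all n derivatives move onto `q`. -/
theorem integral_hermite_mul_poly (n : ℕ) (q : ℝ[X]) :
    ∫ x, (hermiteR n).eval x * q.eval x ∂stdGauss =
      ∫ x, (derivative^[n] q).eval x ∂stdGauss := by
  induction n generalizing q with
  | zero => simp [hermiteR_zero]
  | succ n ih =>
    rw [Function.iterate_succ_apply, ← ih]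
    have h := integral_gaussian_parts (hermiteR n * q) 0
    simp only [zero_mul, Real.exp_zero, mul_one] at h
    have h2 : ∀ x : ℝ, (hermiteR (n + 1)).eval x * q.eval x =
        (hermiteR n).eval x * (derivative q).eval x -
        ((derivative (hermiteR n * q)).eval x + (0 - x) * (hermiteR n * q).eval x) := by
      intro x
      rw [hermiteR_succ]
      simp only [eval_sub, eval_mul, eval_X, derivative_mul, eval_add]
      ring
    simp_rw [h2]
    rw [integral_sub, h, sub_zero]
    · simpa using integrable_poly (hermiteR n * derivative q)
    · exact (integrable_poly (derivative (hermiteR n * q) + (C 0 - X) * (hermiteR n * q))).congr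
        (ae_of_all _ fun x => eval_derivative_add _ 0 x)

theorem integral_hermite_mul_hermite (m n : ℕ) :
    ∫ x, (hermiteR m).eval x * (hermiteR n).eval x ∂stdGauss =
      if m = n then (n.factorial : ℝ) else 0 := by
  have hdeg : ∀ n, (hermiteR n).natDegree = n := fun n => by
    rw [hermiteR, (hermite_monic n).natDegree_map, natDegree_hermite]
  have key : ∀ m n : ℕ, n < m →
      ∫ x, (hermiteR m).eval x * (hermiteR n).eval x ∂stdGauss = 0 := by
    intro m n h
    rw [integral_hermite_mul_poly, iterate_derivative_eq_zero (by rwa [hdeg])]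
    simp
  rcases lt_trichotomy m n with h | rfl | h
  · rw [if_neg h.ne]
    simp_rw [mul_comm ((hermiteR m).eval _)]
    exact key _ _ h
  · rw [if_pos rfl, integral_hermite_mul_poly]
    have : derivative^[m] (hermiteR m) = C (m.factorial : ℝ) := by
      have h0 : (derivative^[m] (hermiteR m)).natDegree ≤ 0 := by
        simpa [hdeg] using natDegree_iterate_derivative (hermiteR m) m
      rw [eq_C_of_natDegree_le_zero h0, coeff_iterate_derivative]
      simp [hermiteR, Nat.descFactorial_self]
    simp [this]
  · rw [if_neg h.ne', key _ _ h]

/-- Translation of the standard Gaussian measure. -/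
theorem integral_gaussian_shift (a : ℝ) (f : ℝ → ℝ) :
    ∫ w, Real.exp (-a ^ 2 / 2 - a * w) * f (w + a) ∂stdGauss = ∫ w, f w ∂stdGauss := by
  rw [integral_gaussianReal_eq_integral_smul one_ne_zero,
    integral_gaussianReal_eq_integral_smul one_ne_zero,
    ← integral_add_right_eq_self (fun x => gaussianPDFReal 0 1 x • f x) a]
  congr 1
  ext w
  simp only [smul_eq_mul, ← mul_assoc, gaussianPDFReal]
  congr 1
  rw [mul_assoc, ← Real.exp_add]
  congr 2
  simp
  ring

/-- The orthonormal functions of one variable that generate the coefficient isometry. -/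
def basisFun (n : ℕ) (s w : ℝ) : ℝ :=
  Real.exp (-s ^ 2 - w * s) * (hermiteR n).eval (w + 2 * s) / √(n.factorial : ℝ)

/-- The one-dimensional Gaussian likelihood ratio. -/
def ratioFun (z s w : ℝ) : ℝ := Real.exp (w * (z - s) - (z - s) ^ 2 / 2)

/-- The squared weight exp(−2s² − 2ws) is the density of 𝒩(−2s, 1) relative to 𝒩(0, 1), under which
w + 2s is standard; this reduces the claim to Hermite orthogonality. -/
theorem integral_basisFun_mul (m n : ℕ) (s : ℝ) :
    ∫ w, basisFun m s w * basisFun n s w ∂stdGauss = if m = n then 1 else 0 := by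
  have h := integral_gaussian_shift (2 * s)
    (fun v => (hermiteR m).eval v * (hermiteR n).eval v / (√(m.factorial : ℝ) * √(n.factorial : ℝ)))
  rw [integral_div, integral_hermite_mul_hermite] at h
  calc _ = _ := by
        congr 1
        ext w
        have : Real.exp (-(2 * s) ^ 2 / 2 - 2 * s * w) =
            Real.exp (-s ^ 2 - w * s) * Real.exp (-s ^ 2 - w * s) := by
          rw [← Real.exp_add]; congr 1; ring
        rw [this, basisFun, basisFun]
        ring
    _ = _ := h
    _ = _ := by
        split_ifs with hmn
        · subst hmn
          rw [Real.mul_self_sqrt (by positivity)]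
          exact div_self (by positivity)
        · simp

theorem integral_basisFun_mul_ratioFun (n : ℕ) (s z : ℝ) :
    ∫ w, basisFun n s w * ratioFun z s w ∂stdGauss =
      Real.exp (s ^ 2 / 2 - z * s) * (z ^ n / √(n.factorial : ℝ)) := by
  have h := integral_gaussian_shift (2 * s)
    (fun v => Real.exp (s ^ 2 / 2 - z * s - z ^ 2 / 2) / √(n.factorial : ℝ) *
      ((hermiteR n).eval v * Real.exp (z * v)))
  rw [integral_const_mul, integral_hermite_mul_exp] at h
  calc _ = _ := by
        congr 1
        ext w
        have : Real.exp (-(2 * s) ^ 2 / 2 - 2 * s * w) * (Real.exp (s ^ 2 / 2 - z * s - z ^ 2 / 2)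
            * Real.exp (z * (w + 2 * s))) = Real.exp (-s ^ 2 - w * s) * ratioFun z s w := by
          rw [ratioFun, ← Real.exp_add, ← Real.exp_add, ← Real.exp_add]; congr 1; ring
        rw [basisFun]
        linear_combination (-(hermiteR n).eval (w + 2 * s) / √(n.factorial : ℝ)) * this
    _ = _ := h
    _ = _ := by
        have : Real.exp (s ^ 2 / 2 - z * s) =
            Real.exp (s ^ 2 / 2 - z * s - z ^ 2 / 2) * Real.exp (z ^ 2 / 2) := by
          rw [← Real.exp_add]; congr 1; ring
        rw [this]
        ring

theorem integral_ratioFun_sq (s z : ℝ) :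
    ∫ w, ratioFun z s w * ratioFun z s w ∂stdGauss = Real.exp ((z - s) ^ 2) := by
  have h := congrFun (mgf_fun_id_gaussianReal (μ := 0) (v := 1)) (2 * (z - s))
  simp only [mgf] at h
  have : ∀ w, ratioFun z s w * ratioFun z s w =
      Real.exp (-(z - s) ^ 2) * Real.exp (2 * (z - s) * w) := by
    intro w
    rw [ratioFun, ← Real.exp_add, ← Real.exp_add]; congr 1; ring
  simp_rw [this]
  rw [integral_const_mul, h, ← Real.exp_add]
  congr 1
  simp
  ring

theorem continuous_basisFun (n : ℕ) (s : ℝ) : Continuous (basisFun n s) := by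
  unfold basisFun; fun_prop

theorem continuous_ratioFun (z s : ℝ) : Continuous (ratioFun z s) := by
  unfold ratioFun; fun_prop

theorem integrable_basisFun_sq (n : ℕ) (s : ℝ) :
    Integrable (fun w => basisFun n s w ^ 2) stdGauss := by
  -- A non-integrable function would have Bochner integral 0, but this integral is known to be 1.
  by_contra h
  have h1 := integral_basisFun_mul n n s
  simp_rw [← sq] at h1
  rw [integral_undef h] at h1
  simp at h1

theorem integrable_ratioFun_sq (z s : ℝ) :
    Integrable (fun w => ratioFun z s w ^ 2) stdGauss := by
  by_contra h
  have h1 := integral_ratioFun_sq s z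
  simp_rw [← sq] at h1
  rw [integral_undef h] at h1
  exact (Real.exp_pos _).ne h1

/-! ### The derivatives of the likelihood ratio -/

/-- Along direction `l` only one factor varies. No differentiability is needed: pulling constants
out of `deriv` and translating hold for its default value too. -/
theorem partialDeriv_const_mul_prod {D : ℕ} (l : Fin D) (C : ℝ) (f : Fin D → ℝ → ℝ) :
    partialDeriv l (fun z => C * ∏ i, f i (z i)) =
      fun z => C * ∏ i, Function.update f l (deriv (f l)) i (z i) := by
  ext z
  have h1 : ∀ t : ℝ, C * ∏ i, f i ((z + t • (Pi.single l 1 : Fin D → ℝ)) i) =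
      (C * ∏ i ∈ Finset.univ.erase l, f i (z i)) * f l (z l + t) := by
    intro t
    rw [← Finset.mul_prod_erase _ _ (Finset.mem_univ l)]
    have : ∏ i ∈ Finset.univ.erase l, f i ((z + t • (Pi.single l 1 : Fin D → ℝ)) i) =
        ∏ i ∈ Finset.univ.erase l, f i (z i) :=
      Finset.prod_congr rfl fun i hi => by simp [Finset.ne_of_mem_erase hi]
    rw [this]
    simp
    ring
  have h2 : ∏ i ∈ Finset.univ.erase l, Function.update f l (deriv (f l)) i (z i) =
      ∏ i ∈ Finset.univ.erase l, f i (z i) :=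
    Finset.prod_congr rfl fun i hi => by
      rw [Function.update_of_ne (Finset.ne_of_mem_erase hi)]
  simp only [partialDeriv, lineDeriv]
  simp_rw [h1]
  rw [deriv_const_mul_field, deriv_comp_const_add, add_zero,
    ← Finset.mul_prod_erase _ _ (Finset.mem_univ l), h2, Function.update_self]
  ring

theorem partialDeriv_iterate_const_mul_prod {D : ℕ} (l : Fin D) (C : ℝ) (f : Fin D → ℝ → ℝ)
    (n : ℕ) : (partialDeriv l)^[n] (fun z => C * ∏ i, f i (z i)) =
      fun z => C * ∏ i, Function.update f l (deriv^[n] (f l)) i (z i) := by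
  induction n with
  | zero => simp
  | succ n ih =>
    rw [Function.iterate_succ_apply', ih, partialDeriv_const_mul_prod, Function.update_self,
      Function.update_idem, Function.iterate_succ_apply']

theorem mixedDeriv_const_mul_prod {D : ℕ} (p : Fin D → ℕ) (C : ℝ) (f : Fin D → ℝ → ℝ) :
    mixedDeriv p (fun z => C * ∏ i, f i (z i)) =
      fun z => C * ∏ i, deriv^[p i] (f i) (z i) := by
  -- Absence of duplicates ensures that each factor is differentiated in a single block, exactly `p
  -- i` times.
  have key : ∀ L : List (Fin D), L.Nodup →
      L.foldr (fun l h => (partialDeriv l)^[p l] h) (fun z => C * ∏ i, f i (z i)) =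
      fun z => C * ∏ i, (if i ∈ L then deriv^[p i] (f i) else f i) (z i) := by
    intro L
    induction L with
    | nil => simp
    | cons l L ih =>
      intro hL
      rw [List.nodup_cons] at hL
      rw [List.foldr_cons, ih hL.2]
      rw [partialDeriv_iterate_const_mul_prod l C (fun i => if i ∈ L then deriv^[p i] (f i) else f i)]
      ext z
      congr 1
      refine Finset.prod_congr rfl fun i _ => ?_
      by_cases hi : i = l
      · subst hi
        simp [hL.1]
      · simp [hi]
  rw [mixedDeriv, key _ (List.nodup_finRange D)]
  simp

/-- Completing the square gives a reflected Gaussian in v − t. The sign (−1)^n from the reflection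
cancels the one in the formula for Gaussian derivatives. -/
theorem iterate_deriv_exp_quadratic (v : ℝ) (n : ℕ) :
    deriv^[n] (fun t : ℝ => Real.exp (v * t - t ^ 2 / 2)) 0 = (hermiteR n).eval v := by
  have h : (fun t : ℝ => Real.exp (v * t - t ^ 2 / 2)) =
      fun t => Real.exp (v ^ 2 / 2) * (fun y : ℝ => Real.exp (-(y ^ 2 / 2))) (v - t) := by
    ext t
    simp only
    rw [← Real.exp_add]
    congr 1
    ring
  rw [← iteratedDeriv_eq_iterate, h, iteratedDeriv_const_mul_field,
    congrFun (iteratedDeriv_comp_const_sub n (fun y : ℝ => Real.exp (-(y ^ 2 / 2))) v) 0,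
    iteratedDeriv_eq_iterate, sub_zero, deriv_gaussian_eq_hermite_mul_gaussian, hermiteR_eval,
    smul_eq_mul]
  have h1 : Real.exp (v ^ 2 / 2) * Real.exp (-(v ^ 2 / 2)) = 1 := by
    rw [← Real.exp_add]; simp
  have h2 : ((-1 : ℝ) ^ n) * (-1) ^ n = 1 := by
    rw [← mul_pow]; simp
  linear_combination (aeval v (hermite n)) * ((-1 : ℝ) ^ n) * (-1) ^ n * h1 +
    (aeval v (hermite n)) * h2

/-! ### Reduced coordinates of the linear Gaussian model -/

theorem dotProduct_self_eq_sqNorm {n : ℕ} (v : Fin n → ℝ) : v ⬝ᵥ v = sqNorm v := by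
  simp [dotProduct, sqNorm, sq]

section ReducedCoordinates

variable {M N : ℕ} {H : Matrix (Fin M) (Fin N) ℝ} (d : ThinSVD H) (σ : ℝ)

/-- The reduced parameter `H̃† x / σ`. -/
def redParam (x : Fin N → ℝ) : Fin H.rank → ℝ := (1 / σ) • (pinv d.Htilde *ᵥ x)

/-- The reduced centred observation `Uᵀ (y - H x₀) / σ`. -/
def redObs (x₀ : Fin N → ℝ) (y : Fin M → ℝ) : Fin H.rank → ℝ :=
  (1 / σ) • (d.Uᵀ *ᵥ (y - H *ᵥ x₀))

theorem sqNorm_U_mulVec (v : Fin H.rank → ℝ) : sqNorm (d.U *ᵥ v) = sqNorm v := by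
  rw [← dotProduct_self_eq_sqNorm, ← dotProduct_self_eq_sqNorm, dotProduct_mulVec,
    vecMul_mulVec, d.U_orth, vecMul_one]

variable {σ}

theorem mulVec_eq_redParam (hσ : 0 < σ) (x : Fin N → ℝ) : H *ᵥ x = σ • (d.U *ᵥ redParam d σ x) := by
  rw [redParam, mulVec_smul, smul_smul, mul_one_div_cancel hσ.ne', one_smul, d.pinv_Htilde,
    mulVec_mulVec, ← Matrix.mul_assoc, ← d.eq_mul]

theorem redParam_Htilde (hσ : 0 < σ) (z : Fin H.rank → ℝ) : redParam d σ (σ • (d.Htilde *ᵥ z)) = z := by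
  rw [redParam, mulVec_smul, smul_smul, one_div_mul_cancel hσ.ne', one_smul, d.pinv_Htilde,
    mulVec_mulVec, Matrix.mul_assoc, ThinSVD.Htilde, ← Matrix.mul_assoc d.Vᵀ, d.V_orth,
    Matrix.one_mul, d.diag_mul_inv, one_mulVec]

theorem sqNorm_mulVec_div (hσ : 0 < σ) (x : Fin N → ℝ) :
    1 / (2 * σ ^ 2) * sqNorm (H *ᵥ x) = ∑ l, redParam d σ x l ^ 2 / 2 := by
  rw [mulVec_eq_redParam d hσ, ← dotProduct_self_eq_sqNorm, smul_dotProduct, dotProduct_smul,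
    dotProduct_self_eq_sqNorm, sqNorm_U_mulVec, ← Finset.sum_div]
  simp only [sqNorm, smul_eq_mul]
  field_simp

theorem dotProduct_gram_div (hσ : 0 < σ) (x x₀ : Fin N → ℝ) :
    1 / σ ^ 2 * (x ⬝ᵥ (Hᵀ * H) *ᵥ x₀) = ∑ l, redParam d σ x l * redParam d σ x₀ l := by
  rw [← mulVec_mulVec, dotProduct_mulVec, vecMul_transpose, mulVec_eq_redParam d hσ,
    mulVec_eq_redParam d hσ, smul_dotProduct, dotProduct_smul, dotProduct_mulVec, vecMul_mulVec,
    d.U_orth, vecMul_one]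
  simp only [dotProduct, smul_eq_mul]
  field_simp

/-- Expand ‖y − Hx‖² about y − Hx₀: the square ‖y − Hx₀‖² cancels in the ratio, and the cross term
sees the observation only through Uᵀ(y − Hx₀). -/
theorem likelihoodRatio_eq (hσ : 0 < σ) (x₀ : Fin N → ℝ) (y : Fin M → ℝ) (x : Fin N → ℝ) :
    likelihoodRatio H σ x₀ y x =
      ∏ l, ratioFun (redParam d σ x l) (redParam d σ x₀ l) (redObs d σ x₀ y l) := by
  have hc : (0 : ℝ) < 1 / (2 * Real.pi * σ ^ 2) ^ ((M : ℝ) / 2) := by positivity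
  rw [likelihoodRatio, pdf, pdf, mul_div_mul_left _ _ hc.ne', ← Real.exp_sub]
  simp only [ratioFun]
  rw [← Real.exp_sum]
  congr 1
  rw [Finset.sum_sub_distrib]
  set s := redParam d σ x₀
  set z := redParam d σ x
  set w := y - H *ᵥ x₀ with hw
  have h1 : y - H *ᵥ x = w - σ • (d.U *ᵥ (z - s)) := by
    rw [mulVec_sub, smul_sub, ← mulVec_eq_redParam d hσ, ← mulVec_eq_redParam d hσ, hw]
    abel
  have h2 : sqNorm (y - H *ᵥ x) = sqNorm w - 2 * σ * (w ⬝ᵥ (d.U *ᵥ (z - s))) +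
      σ ^ 2 * sqNorm (z - s) := by
    rw [h1]
    clear_value w
    rw [← dotProduct_self_eq_sqNorm, sub_dotProduct, dotProduct_sub, dotProduct_sub,
      dotProduct_self_eq_sqNorm, dotProduct_comm (σ • _) w, dotProduct_smul, smul_dotProduct,
      dotProduct_smul, dotProduct_self_eq_sqNorm, sqNorm_U_mulVec]
    simp only [smul_eq_mul]
    ring
  have h3 : ∑ l, redObs d σ x₀ y l * (z l - s l) = 1 / σ * (w ⬝ᵥ (d.U *ᵥ (z - s))) := by
    rw [dotProduct_mulVec, ← mulVec_transpose]
    simp only [redObs, dotProduct, Finset.mul_sum, Pi.smul_apply, smul_eq_mul, Pi.sub_apply]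
    exact Finset.sum_congr rfl fun _ _ => by ring
  rw [h3, h2, ← Finset.sum_div]
  simp only [sqNorm, Pi.sub_apply]
  field_simp
  ring

/-- The orthonormal functions in the space of square integrable statistics. -/
def basisStat (d : ThinSVD H) (σ : ℝ) (x₀ : Fin N → ℝ) (p : Fin H.rank → ℕ) (y : Fin M → ℝ) : ℝ :=
  ∏ l, basisFun (p l) (redParam d σ x₀ l) (redObs d σ x₀ y l)

/-- The ratio contributes (w + s)z to the exponent and the extra exponential contributes sz; this is
the source of the argument w + 2s. -/
theorem chi_eq (hσ : 0 < σ) (x₀ : Fin N → ℝ) (p : Fin H.rank → ℕ) (y : Fin M → ℝ) :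
    chi d σ x₀ p y = ∏ l, (Real.exp (-redParam d σ x₀ l ^ 2 / 2 -
        redObs d σ x₀ y l * redParam d σ x₀ l) *
      (hermiteR (p l)).eval (redObs d σ x₀ y l + 2 * redParam d σ x₀ l)) := by
  set s := redParam d σ x₀ with hs
  set w := redObs d σ x₀ y
  have h : (fun z : Fin H.rank → ℝ => likelihoodRatio H σ x₀ y (σ • (d.Htilde *ᵥ z)) *
      Real.exp (1 / σ * (x₀ ⬝ᵥ (Hᵀ * H * d.Htilde) *ᵥ z))) =
      fun z => (∏ l, Real.exp (-s l ^ 2 / 2 - w l * s l)) *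
        ∏ l, (fun t : ℝ => Real.exp ((w l + 2 * s l) * t - t ^ 2 / 2)) (z l) := by
    ext z
    have h1 : 1 / σ * (x₀ ⬝ᵥ (Hᵀ * H * d.Htilde) *ᵥ z) = ∑ l, z l * s l := by
      have := dotProduct_gram_div d hσ (σ • (d.Htilde *ᵥ z)) x₀
      rw [redParam_Htilde d hσ] at this
      rw [← this, ← mulVec_mulVec, smul_dotProduct, dotProduct_comm (d.Htilde *ᵥ z),
        dotProduct_mulVec, ← mulVec_transpose (Hᵀ * H)]
      simp only [transpose_mul, transpose_transpose, smul_eq_mul]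
      field_simp
    rw [h1, likelihoodRatio_eq d hσ, redParam_Htilde d hσ, Real.exp_sum, ← Finset.prod_mul_distrib,
      ← Finset.prod_mul_distrib]
    refine Finset.prod_congr rfl fun l _ => ?_
    rw [ratioFun, ← Real.exp_add, ← Real.exp_add]
    congr 1
    ring
  rw [chi, h, mixedDeriv_const_mul_prod p _
    (fun l (t : ℝ) => Real.exp ((w l + 2 * s l) * t - t ^ 2 / 2))]
  simp only [Pi.zero_apply, iterate_deriv_exp_quadratic]
  rw [Finset.prod_mul_distrib]

/-- The prefactor is the product of the exp(−s²/2), which supplies the missing half of the −s² in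
`basisFun`. -/
theorem partialSum_eq (hσ : 0 < σ) (x₀ : Fin N → ℝ) (a : ell2 H.rank) (F : Finset (Fin H.rank → ℕ))
    (y : Fin M → ℝ) :
    partialSum d σ x₀ a F y = ∑ p ∈ F, a p * basisStat d σ x₀ p y := by
  rw [partialSum, neg_mul, sqNorm_mulVec_div d hσ, Finset.mul_sum]
  refine Finset.sum_congr rfl fun p _ => ?_
  have h : basisStat d σ x₀ p y = (∏ l, Real.exp (-(redParam d σ x₀ l ^ 2 / 2))) *
      (∏ l, (Real.exp (-redParam d σ x₀ l ^ 2 / 2 - redObs d σ x₀ y l * redParam d σ x₀ l) *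
        (hermiteR (p l)).eval (redObs d σ x₀ y l + 2 * redParam d σ x₀ l))) /
      ∏ l, √((p l).factorial : ℝ) := by
    rw [basisStat, ← Finset.prod_mul_distrib, ← Finset.prod_div_distrib]
    refine Finset.prod_congr rfl fun l _ => ?_
    rw [basisFun, ← mul_assoc, ← Real.exp_add]
    congr 3
    ring
  rw [chi_eq d hσ, mfact, Real.sqrt_prod _ (fun _ _ => by positivity), ← Finset.sum_neg_distrib,
    Real.exp_sum, h]
  ring

end ReducedCoordinates

/-! ### The law of the observation -/

theorem pi_withDensity_ofReal {n : ℕ} (f : Fin n → ℝ → ℝ) (h0 : ∀ i x, 0 ≤ f i x)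
    (hf : ∀ i, Integrable (f i)) :
    Measure.pi (fun i => (volume : Measure ℝ).withDensity fun x => ENNReal.ofReal (f i x)) =
      (volume : Measure (Fin n → ℝ)).withDensity fun x => ENNReal.ofReal (∏ i, f i (x i)) := by
  have : ∀ i, IsFiniteMeasure ((volume : Measure ℝ).withDensity fun x => ENNReal.ofReal (f i x)) :=
    fun i => isFiniteMeasure_withDensity_ofReal (hf i).2
  refine Measure.pi_eq fun s hs => ?_
  rw [withDensity_apply _ (MeasurableSet.univ_pi hs), volume_pi, Measure.restrict_pi_pi,
    ← ofReal_integral_eq_lintegral_ofReal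
      (Integrable.fintype_prod fun i => (hf i).restrict)
      (ae_of_all _ fun x => Finset.prod_nonneg fun i _ => h0 i _),
    integral_fintype_prod_eq_prod,
    ENNReal.ofReal_prod_of_nonneg fun i _ => integral_nonneg fun x => h0 i x]
  refine Finset.prod_congr rfl fun i _ => ?_
  rw [withDensity_apply _ (hs i), ofReal_integral_eq_lintegral_ofReal (hf i).restrict
    (ae_of_all _ fun x => h0 i x)]

/-- The standard Gaussian measure on `ℝⁿ`. -/
abbrev stdGaussPi (n : ℕ) : Measure (Fin n → ℝ) := Measure.pi fun _ => stdGauss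

section Law

variable {M N : ℕ} (H : Matrix (Fin M) (Fin N) ℝ) {σ : ℝ}

theorem law_eq_pi (hσ : 0 < σ) (x : Fin N → ℝ) :
    law H σ x = Measure.pi fun i => gaussianReal ((H *ᵥ x) i) (NNReal.mk (σ ^ 2) (sq_nonneg σ)) := by
  have hv : NNReal.mk (σ ^ 2) (sq_nonneg σ) ≠ 0 := by
    exact fun h => pow_ne_zero 2 hσ.ne' (congrArg NNReal.toReal h)
  simp_rw [gaussianReal_of_var_ne_zero _ hv]
  unfold gaussianPDF
  rw [pi_withDensity_ofReal
    (fun i => gaussianPDFReal ((H *ᵥ x) i) (NNReal.mk (σ ^ 2) (sq_nonneg σ)))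
    (fun i x => gaussianPDFReal_nonneg _ _ _) (fun i => integrable_gaussianPDFReal _ _), law]
  congr 1
  ext y
  congr 1
  simp only [gaussianPDFReal, NNReal.coe_mk]
  rw [Finset.prod_mul_distrib, ← Real.exp_sum, pdf]
  congr 1
  · rw [Finset.prod_const, Finset.card_univ, Fintype.card_fin, inv_pow, Real.sqrt_eq_rpow,
      ← Real.rpow_natCast _ M, ← Real.rpow_mul (by positivity), one_div]
    congr 2
    ring
  · congr 1
    rw [sqNorm, Finset.mul_sum]
    refine Finset.sum_congr rfl fun i _ => ?_
    simp only [Pi.sub_apply]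
    ring

theorem isProbabilityMeasure_law (hσ : 0 < σ) (x : Fin N → ℝ) :
    IsProbabilityMeasure (law H σ x) := by
  rw [law_eq_pi H hσ]
  infer_instance

theorem law_eq_map (hσ : 0 < σ) (x : Fin N → ℝ) :
    law H σ x = (stdGaussPi M).map fun n => H *ᵥ x + σ • n := by
  have h : ∀ i, (stdGauss.map fun t => (H *ᵥ x) i + σ * t) =
      gaussianReal ((H *ᵥ x) i) (NNReal.mk (σ ^ 2) (sq_nonneg σ)) := fun i => by
    have := gaussianReal_map_const_add (μ := 0) (v := (NNReal.mk (σ ^ 2) (sq_nonneg σ))) ((H *ᵥ x) i)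
    have h2 := gaussianReal_map_const_mul (μ := 0) (v := 1) σ
    rw [mul_zero, mul_one] at h2
    rw [zero_add, ← h2, Measure.map_map (by fun_prop) (by fun_prop)] at this
    exact this
  have hp : ∀ i, IsProbabilityMeasure (stdGauss.map fun t => (H *ᵥ x) i + σ * t) := fun i => by
    rw [h]; infer_instance
  rw [law_eq_pi H hσ]
  simp_rw [← h]
  rw [← Measure.pi_map_pi (fun i => by fun_prop)]
  rfl

theorem charFunDual_stdGaussPi {n : ℕ} (L : StrongDual ℝ (Fin n → ℝ)) :
    charFunDual (stdGaussPi n) L =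
      Complex.exp (-(((∑ i, L (Pi.single i 1) ^ 2 : ℝ) : ℂ) / 2)) := by
  have hL : ∀ v, L v = ∑ i, v i * L (Pi.single i 1) := fun v => by
    conv_lhs => rw [← Finset.univ_sum_single v]
    rw [map_sum]
    refine Finset.sum_congr rfl fun i _ => ?_
    rw [← smul_eq_mul, ← map_smul, ← Pi.single_smul, smul_eq_mul, mul_one]
  have h1 : ∀ v : Fin n → ℝ, Complex.exp (L v * Complex.I) =
      ∏ i, (fun i (t : ℝ) => Complex.exp ((L (Pi.single i 1) : ℝ) * t * Complex.I)) i (v i) := by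
    intro v
    rw [hL, ← Complex.exp_sum]
    congr 1
    push_cast
    rw [Finset.sum_mul]
    exact Finset.sum_congr rfl fun i _ => by ring
  rw [charFunDual_apply]
  rw [integral_congr_ae (ae_of_all _ h1), integral_fintype_prod_eq_prod
    (fun i (t : ℝ) => Complex.exp ((L (Pi.single i 1) : ℝ) * t * Complex.I))]
  simp_rw [← charFun_apply_real, charFun_gaussianReal]
  rw [← Complex.exp_sum]
  congr 1
  push_cast
  rw [Finset.sum_div, ← Finset.sum_neg_distrib]
  exact Finset.sum_congr rfl fun i _ => by simp

/-- Matrices with orthonormal columns reduce standard Gaussian vectors to such vectors. -/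
theorem stdGaussPi_map_transpose {m n : ℕ} (U : Matrix (Fin m) (Fin n) ℝ) (hU : Uᵀ * U = 1) :
    (stdGaussPi m).map (fun v => Uᵀ *ᵥ v) = stdGaussPi n := by
  let A : (Fin m → ℝ) →L[ℝ] (Fin n → ℝ) := LinearMap.toContinuousLinearMap (Matrix.mulVecLin Uᵀ)
  have hA : (fun v => Uᵀ *ᵥ v) = A := rfl
  have : IsProbabilityMeasure ((stdGaussPi m).map A) :=
    Measure.isProbabilityMeasure_map (by fun_prop)
  rw [hA]
  refine Measure.ext_of_charFunDual ?_
  ext L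
  rw [charFunDual_map, charFunDual_stdGaussPi, charFunDual_stdGaussPi]
  congr 4
  -- The characteristic function depends only on the Euclidean norm of the coefficient vector, and
  -- pulling back replaces `c` by `U *ᵥ c`, of equal norm.
  set c : Fin n → ℝ := fun k => L (Pi.single k 1) with hc
  have h1 : ∀ i, (L.comp A) (Pi.single i 1) = (U *ᵥ c) i := fun i => by
    have hv : A (Pi.single i 1) = ∑ k, U i k • (Pi.single k 1 : Fin n → ℝ) := by
      ext k
      simp [A, Finset.sum_apply, Pi.single_apply]
    rw [ContinuousLinearMap.comp_apply, hv, map_sum]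
    simp [mulVec, dotProduct, hc]
  simp_rw [h1]
  change sqNorm (U *ᵥ c) = sqNorm c
  rw [← dotProduct_self_eq_sqNorm, ← dotProduct_self_eq_sqNorm, dotProduct_mulVec,
    vecMul_mulVec, hU, vecMul_one]

variable {H}

theorem continuous_redObs (d : ThinSVD H) (x₀ : Fin N → ℝ) : Continuous (redObs d σ x₀) := by
  unfold redObs
  fun_prop

theorem measurePreserving_redObs (hσ : 0 < σ) (d : ThinSVD H) (x₀ : Fin N → ℝ) :
    MeasurePreserving (redObs d σ x₀) (law H σ x₀) (stdGaussPi H.rank) := by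
  refine ⟨(continuous_redObs d x₀).measurable, ?_⟩
  rw [law_eq_map H hσ, Measure.map_map (continuous_redObs d x₀).measurable (by fun_prop),
    ← stdGaussPi_map_transpose d.U d.U_orth]
  congr 1
  ext v
  simp [redObs, mulVec_smul, inv_mul_cancel_left₀ hσ.ne']

theorem pdf_pos (hσ : 0 < σ) (y : Fin M → ℝ) (x : Fin N → ℝ) : 0 < pdf H σ y x := by
  have : (0 : ℝ) < 1 / (2 * Real.pi * σ ^ 2) ^ ((M : ℝ) / 2) := by positivity
  exact mul_pos this (Real.exp_pos _)

theorem continuous_pdf (x : Fin N → ℝ) : Continuous fun y => pdf H σ y x := by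
  unfold pdf sqNorm
  fun_prop

theorem continuous_likelihoodRatio (hσ : 0 < σ) (x₀ x : Fin N → ℝ) :
    Continuous fun y => likelihoodRatio H σ x₀ y x :=
  (continuous_pdf x).div (continuous_pdf x₀) fun y => (pdf_pos hσ y x₀).ne'

theorem law_eq_withDensity (hσ : 0 < σ) (x₀ x : Fin N → ℝ) :
    law H σ x = (law H σ x₀).withDensity fun y =>
      ENNReal.ofReal (likelihoodRatio H σ x₀ y x) := by
  rw [law, law, ← withDensity_mul _ (continuous_pdf x₀).measurable.ennreal_ofReal
    (continuous_likelihoodRatio hσ x₀ x).measurable.ennreal_ofReal]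
  congr 1
  ext y
  rw [Pi.mul_apply, ← ENNReal.ofReal_mul (pdf_pos hσ y x₀).le, likelihoodRatio,
    mul_div_cancel₀ _ (pdf_pos hσ y x₀).ne']

theorem likelihoodRatio_nonneg (hσ : 0 < σ) (x₀ x : Fin N → ℝ) (y : Fin M → ℝ) :
    0 ≤ likelihoodRatio H σ x₀ y x :=
  div_nonneg (pdf_pos hσ y x).le (pdf_pos hσ y x₀).le

theorem integral_law (hσ : 0 < σ) (x₀ x : Fin N → ℝ) (f : (Fin M → ℝ) → ℝ) :
    ∫ y, f y ∂(law H σ x) = ∫ y, likelihoodRatio H σ x₀ y x * f y ∂(law H σ x₀) := by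
  rw [law_eq_withDensity hσ x₀ x, integral_withDensity_eq_integral_toReal_smul
    (continuous_likelihoodRatio hσ x₀ x).measurable.ennreal_ofReal
    (ae_of_all _ fun _ => ENNReal.ofReal_lt_top)]
  simp_rw [ENNReal.toReal_ofReal (likelihoodRatio_nonneg hσ x₀ x _), smul_eq_mul]

theorem integrable_law_iff (hσ : 0 < σ) (x₀ x : Fin N → ℝ) (f : (Fin M → ℝ) → ℝ) :
    Integrable f (law H σ x) ↔
      Integrable (fun y => likelihoodRatio H σ x₀ y x * f y) (law H σ x₀) := by
  rw [law_eq_withDensity hσ x₀ x, integrable_withDensity_iff_integrable_smul'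
    (continuous_likelihoodRatio hσ x₀ x).measurable.ennreal_ofReal
    (ae_of_all _ fun _ => ENNReal.ofReal_lt_top)]
  simp_rw [ENNReal.toReal_ofReal (likelihoodRatio_nonneg hσ x₀ x _), smul_eq_mul]

/-- Statistics that are products of functions of the reduced observation. -/
theorem integral_prod_redObs (hσ : 0 < σ) (d : ThinSVD H) (x₀ : Fin N → ℝ)
    (f : Fin H.rank → ℝ → ℝ) (hf : ∀ l, Continuous (f l)) :
    ∫ y, ∏ l, f l (redObs d σ x₀ y l) ∂(law H σ x₀) = ∏ l, ∫ w, f l w ∂stdGauss := by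
  have h := measurePreserving_redObs hσ d x₀
  rw [← integral_fintype_prod_eq_prod (μ := fun _ => stdGauss) f]
  change _ = ∫ w, _ ∂(stdGaussPi H.rank)
  rw [← h.map_eq, integral_map]
  · exact h.measurable.aemeasurable
  · exact Continuous.aestronglyMeasurable (by fun_prop)

theorem memLp_prod_redObs (hσ : 0 < σ) (d : ThinSVD H) (x₀ : Fin N → ℝ)
    (f : Fin H.rank → ℝ → ℝ) (hf : ∀ l, Continuous (f l))
    (hi : ∀ l, Integrable (fun w => f l w ^ 2) stdGauss) :
    MemLp (fun y => ∏ l, f l (redObs d σ x₀ y l)) 2 (law H σ x₀) := by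
  have h := measurePreserving_redObs hσ d x₀
  have hm : MemLp (fun w => ∏ l, f l (w l)) 2 (stdGaussPi H.rank) := by
    rw [memLp_two_iff_integrable_sq (Continuous.aestronglyMeasurable (by fun_prop))]
    simp_rw [← Finset.prod_pow]
    exact Integrable.fintype_prod (f := fun l w => f l w ^ 2) hi
  exact hm.comp_measurePreserving h

end Law

/-! ### The orthonormal statistics and the likelihood ratios -/

section Statistics

variable {M N : ℕ} {H : Matrix (Fin M) (Fin N) ℝ} {σ : ℝ}

theorem memLp_basisStat (hσ : 0 < σ) (d : ThinSVD H) (x₀ : Fin N → ℝ) (p : Fin H.rank → ℕ) :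
    MemLp (basisStat d σ x₀ p) 2 (law H σ x₀) :=
  memLp_prod_redObs hσ d x₀ (fun l => basisFun (p l) (redParam d σ x₀ l))
    (fun _ => continuous_basisFun _ _) (fun _ => integrable_basisFun_sq _ _)

theorem memLp_likelihoodRatio (hσ : 0 < σ) (d : ThinSVD H) (x₀ x : Fin N → ℝ) :
    MemLp (fun y => likelihoodRatio H σ x₀ y x) 2 (law H σ x₀) := by
  simp_rw [likelihoodRatio_eq d hσ]
  exact memLp_prod_redObs hσ d x₀ (fun l => ratioFun (redParam d σ x l) (redParam d σ x₀ l))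
    (fun _ => continuous_ratioFun _ _) (fun _ => integrable_ratioFun_sq _ _)

theorem inner_toLp {α : Type*} {mα : MeasurableSpace α} {μ : Measure α} {f g : α → ℝ}
    (hf : MemLp f 2 μ) (hg : MemLp g 2 μ) :
    inner ℝ (hf.toLp f) (hg.toLp g) = ∫ y, f y * g y ∂μ := by
  rw [L2.inner_def]
  refine integral_congr_ae ?_
  filter_upwards [hf.coeFn_toLp, hg.coeFn_toLp] with y h1 h2
  rw [h1, h2]
  simp [mul_comm]

/-- The orthonormal family of square integrable statistics. -/
def basisVec (hσ : 0 < σ) (d : ThinSVD H) (x₀ : Fin N → ℝ) (p : Fin H.rank → ℕ) :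
    Lp ℝ 2 (law H σ x₀) :=
  (memLp_basisStat hσ d x₀ p).toLp _

/-- The likelihood ratio as a vector of the space of square integrable statistics. -/
def ratioVec (hσ : 0 < σ) (d : ThinSVD H) (x₀ x : Fin N → ℝ) : Lp ℝ 2 (law H σ x₀) :=
  (memLp_likelihoodRatio hσ d x₀ x).toLp _

theorem orthonormal_basisVec (hσ : 0 < σ) (d : ThinSVD H) (x₀ : Fin N → ℝ) :
    Orthonormal ℝ (basisVec hσ d x₀) := by
  classical
  rw [orthonormal_iff_ite]
  intro p q
  rw [basisVec, basisVec, inner_toLp]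
  simp_rw [basisStat, ← Finset.prod_mul_distrib]
  rw [integral_prod_redObs hσ d x₀ (fun l w => basisFun (p l) (redParam d σ x₀ l) w *
    basisFun (q l) (redParam d σ x₀ l) w)
    (fun l => (continuous_basisFun _ _).mul (continuous_basisFun _ _))]
  simp_rw [integral_basisFun_mul]
  split_ifs with h
  · simp [h]
  · obtain ⟨l, hl⟩ := Function.ne_iff.mp h
    exact Finset.prod_eq_zero (Finset.mem_univ l) (if_neg hl)

theorem inner_basisVec_ratioVec (hσ : 0 < σ) (d : ThinSVD H) (x₀ x : Fin N → ℝ)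
    (p : Fin H.rank → ℕ) :
    inner ℝ (basisVec hσ d x₀ p) (ratioVec hσ d x₀ x) =
      ∏ l, (Real.exp (redParam d σ x₀ l ^ 2 / 2 - redParam d σ x l * redParam d σ x₀ l) *
        (redParam d σ x l ^ p l / √((p l).factorial : ℝ))) := by
  rw [basisVec, ratioVec, inner_toLp]
  simp_rw [likelihoodRatio_eq d hσ, basisStat, ← Finset.prod_mul_distrib]
  rw [integral_prod_redObs hσ d x₀ (fun l w => basisFun (p l) (redParam d σ x₀ l) w *
    ratioFun (redParam d σ x l) (redParam d σ x₀ l) w)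
    (fun l => (continuous_basisFun _ _).mul (continuous_ratioFun _ _))]
  simp_rw [integral_basisFun_mul_ratioFun]

theorem norm_sq_ratioVec (hσ : 0 < σ) (d : ThinSVD H) (x₀ x : Fin N → ℝ) :
    ‖ratioVec hσ d x₀ x‖ ^ 2 =
      ∏ l, Real.exp ((redParam d σ x l - redParam d σ x₀ l) ^ 2) := by
  rw [← real_inner_self_eq_norm_sq, ratioVec, inner_toLp]
  simp_rw [likelihoodRatio_eq d hσ, ← Finset.prod_mul_distrib]
  rw [integral_prod_redObs hσ d x₀ (fun l w => ratioFun (redParam d σ x l) (redParam d σ x₀ l) w *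
    ratioFun (redParam d σ x l) (redParam d σ x₀ l) w)
    (fun l => (continuous_ratioFun _ _).mul (continuous_ratioFun _ _))]
  simp_rw [integral_ratioFun_sq]

/-- The likelihood ratios lie in the closed span of the orthonormal family. -/
theorem synth_coeffs_ratioVec (hσ : 0 < σ) (d : ThinSVD H) (x₀ x : Fin N → ℝ) :
    synth (orthonormal_basisVec hσ d x₀) (coeffs (orthonormal_basisVec hσ d x₀)
      (ratioVec hσ d x₀ x)) = ratioVec hσ d x₀ x := by
  refine synth_coeffs_of_hasSum _ ?_
  rw [norm_sq_ratioVec]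
  simp_rw [inner_basisVec_ratioVec, ← Finset.prod_pow]
  refine hasSum_prod_multiindex (fun l n =>
    (Real.exp (redParam d σ x₀ l ^ 2 / 2 - redParam d σ x l * redParam d σ x₀ l) *
      (redParam d σ x l ^ n / √(n.factorial : ℝ))) ^ 2) _ (fun _ _ => sq_nonneg _) fun l => ?_
  set s := redParam d σ x₀ l
  set z := redParam d σ x l
  -- Parseval in one coordinate: exp(s² − 2zs) ∑ z^{2n}/n! = exp((z − s)²).
  have h := (NormedSpace.expSeries_div_hasSum_exp (𝔸 := ℝ) (z ^ 2)).mul_left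
    (Real.exp (s ^ 2 / 2 - z * s) ^ 2)
  rw [← Real.exp_eq_exp_ℝ, ← Real.exp_nat_mul, ← Real.exp_add] at h
  have h2 : (z - s) ^ 2 = ((2 : ℕ) : ℝ) * (s ^ 2 / 2 - z * s) + z ^ 2 := by push_cast; ring
  rw [h2]
  have h3 : (fun n : ℕ => (Real.exp (s ^ 2 / 2 - z * s) * (z ^ n / √(n.factorial : ℝ))) ^ 2) =
      fun n => Real.exp (((2 : ℕ) : ℝ) * (s ^ 2 / 2 - z * s)) * ((z ^ 2) ^ n / n.factorial) := by
    funext n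
    rw [mul_pow, div_pow, Real.sq_sqrt (by positivity), ← Real.exp_nat_mul, pow_right_comm]
  rw [h3]
  exact h

/-! ### Consistent coefficient sequences and allowed estimators -/

variable {S : ℕ} (g c : sparseSet N S → ℝ) (x₀ : sparseSet N S)

/-- The series defining 𝒞(c), times its exponential prefactor, is termwise an ℓ² inner product; its
summability is therefore automatic. -/
theorem mem_coeffSet_iff (hσ : 0 < σ) (d : ThinSVD H) (a : ell2 H.rank) :
    a ∈ coeffSet d σ S g c x₀ ↔ ∀ x : sparseSet N S,
      inner ℝ a (coeffs (orthonormal_basisVec hσ d x₀) (ratioVec hσ d x₀ x)) = c x + g x := by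
  refine forall_congr' fun x => ?_
  have hs := lp.hasSum_inner (𝕜 := ℝ) a
    (coeffs (orthonormal_basisVec hσ d x₀) (ratioVec hσ d x₀ x))
  set K := Real.exp (1 / (2 * σ ^ 2) * sqNorm (H *ᵥ (x₀ : Fin N → ℝ))
    - 1 / σ ^ 2 * ((x : Fin N → ℝ) ⬝ᵥ (Hᵀ * H) *ᵥ (x₀ : Fin N → ℝ))) with hK
  have hK0 : K ≠ 0 := (Real.exp_pos _).ne'
  have hK1 : K = ∏ l, Real.exp (redParam d σ x₀ l ^ 2 / 2 -
      redParam d σ x l * redParam d σ x₀ l) := by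
    rw [hK, sqNorm_mulVec_div d hσ, dotProduct_gram_div d hσ, ← Finset.sum_sub_distrib,
      Real.exp_sum]
  have hterm : ∀ p, inner ℝ (a p) (coeffs (orthonormal_basisVec hσ d x₀)
      (ratioVec hσ d x₀ x) p) =
      K * (a p / √(mfact p) * mpow ((1 / σ) • (pinv d.Htilde *ᵥ (x : Fin N → ℝ))) p) := by
    intro p
    rw [coeffs_apply, inner_basisVec_ratioVec, Finset.prod_mul_distrib, ← hK1, mfact,
      Real.sqrt_prod _ (fun _ _ => by positivity), Finset.prod_div_distrib, mpow,
      show ∀ u v : ℝ, inner ℝ u v = v * u from fun _ _ => rfl]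
    simp only [redParam]
    ring
  simp_rw [hterm] at hs
  have hs2 := (hasSum_mul_left_iff hK0).mp
    (by rwa [← mul_inv_cancel_left₀ hK0 (inner ℝ a (coeffs _ _))] at hs)
  rw [and_iff_right hs2.summable, hs2.tsum_eq, mul_inv_cancel_left₀ hK0]
  exact eq_sub_iff_add_eq.trans eq_comm

/-- Allowed estimators are the solutions of a linear system in the space of square integrable
statistics. -/
theorem mem_allowed_iff (hσ : 0 < σ) (d : ThinSVD H) (ghat : (Fin M → ℝ) → ℝ) :
    ghat ∈ allowed H σ S g c x₀ ↔ ∃ h : MemLp ghat 2 (law H σ x₀), ∀ x : sparseSet N S,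
      inner ℝ (h.toLp ghat) (ratioVec hσ d x₀ x) = c x + g x := by
  have hP := isProbabilityMeasure_law H hσ x₀
  have hinner : ∀ (h : MemLp ghat 2 (law H σ x₀)) (x : sparseSet N S),
      inner ℝ (h.toLp ghat) (ratioVec hσ d x₀ x) = ∫ y, ghat y ∂(law H σ x) := by
    intro h x
    rw [ratioVec, inner_toLp, integral_law hσ (x₀ : Fin N → ℝ) (x : Fin N → ℝ)]
    simp_rw [mul_comm (ghat _)]
  constructor
  · rintro ⟨hv, hx⟩
    have h : MemLp ghat 2 (law H σ x₀) :=
      (evariance_lt_top_iff_memLp (hx x₀).1.aestronglyMeasurable).mp hv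
    refine ⟨h, fun x => ?_⟩
    rw [hinner, ← (hx x).2]
    ring
  · rintro ⟨h, hx⟩
    have hv : evariance ghat (law H σ x₀) < ⊤ := evariance_lt_top h
    refine ⟨hv, fun x => ⟨?_, ?_⟩⟩
    · rw [integrable_law_iff hσ (x₀ : Fin N → ℝ) (x : Fin N → ℝ)]
      -- By Cauchy–Schwarz, square integrability at x₀ alone makes the mean exist at every x.
      exact (memLp_likelihoodRatio hσ d x₀ x).integrable_mul h
    · rw [← hinner h, hx]
      ring

/-- The bias condition at x₀ fixes the mean, so minimising variance is minimising the L² norm. -/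
theorem variance_eq_of_mem_allowed (hσ : 0 < σ) {ghat : (Fin M → ℝ) → ℝ}
    (hg : ghat ∈ allowed H σ S g c x₀) (h : MemLp ghat 2 (law H σ x₀)) :
    variance H σ ghat x₀ = ENNReal.ofReal (‖h.toLp ghat‖ ^ 2 - (c x₀ + g x₀) ^ 2) := by
  have hP := isProbabilityMeasure_law H hσ x₀
  rw [variance, ← ofReal_variance h, variance_eq_sub h, ← (hg.2 x₀).2,
    ← real_inner_self_eq_norm_sq, inner_toLp]
  simp [sq]

/-- The sum of the series estimator is the synthesis of its coefficient sequence. -/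
theorem isSeriesEstimator_iff (hσ : 0 < σ) (d : ThinSVD H) (x₀ : Fin N → ℝ) (a : ell2 H.rank)
    (ghat : (Fin M → ℝ) → ℝ) :
    IsSeriesEstimator d σ x₀ a ghat ↔ ∃ h : MemLp ghat 2 (law H σ x₀),
      h.toLp ghat = synth (orthonormal_basisVec hσ d x₀) a := by
  have hpm : ∀ F, MemLp (fun y => partialSum d σ x₀ a F y) 2 (law H σ x₀) := fun F => by
    simp_rw [partialSum_eq d hσ]
    exact memLp_finsetSum _ fun p _ => (memLp_basisStat hσ d x₀ p).const_mul _
  have hpl : ∀ F, (hpm F).toLp _ = ∑ p ∈ F, a p • basisVec hσ d x₀ p := fun F => by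
    refine Lp.ext ((hpm F).coeFn_toLp.trans ?_)
    have h1 : ∀ p ∈ F, ⇑(a p • basisVec hσ d x₀ p) =ᵐ[law H σ x₀]
        fun y => a p * basisStat d σ x₀ p y := fun p _ => by
      filter_upwards [Lp.coeFn_smul (a p) (basisVec hσ d x₀ p),
        (memLp_basisStat hσ d x₀ p).coeFn_toLp] with y h2 h3
      rw [h2, Pi.smul_apply, basisVec, h3, smul_eq_mul]
    have h4 := (Lp.coeFn_finsetSum F fun p => a p • basisVec hσ d x₀ p)
    filter_upwards [h4, (eventually_all_finset F).mpr h1] with y h5 h6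
    rw [h5, Finset.sum_apply, partialSum_eq d hσ]
    exact Finset.sum_congr rfl fun p hp => (h6 p hp).symm
  have hsum := hasSum_synth (orthonormal_basisVec hσ d x₀) a
  have hlim : ∀ h : MemLp ghat 2 (law H σ x₀),
      (Tendsto (fun F => eLpNorm (fun y => ghat y - partialSum d σ x₀ a F y) 2 (law H σ x₀))
        atTop (𝓝 0) ↔ h.toLp ghat = synth (orthonormal_basisVec hσ d x₀) a) := by
    intro h
    have h1 := Lp.tendsto_Lp_iff_tendsto_eLpNorm'' (fun F y => partialSum d σ x₀ a F y) hpm ghat h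
      (fi := atTop)
    have h2 : ∀ F, eLpNorm (fun y => ghat y - partialSum d σ x₀ a F y) 2 (law H σ x₀) =
        eLpNorm ((fun y => partialSum d σ x₀ a F y) - ghat) 2 (law H σ x₀) := fun F => by
      rw [← eLpNorm_neg]
      congr 1
      ext y
      simp
    simp_rw [h2]
    rw [← h1]
    simp_rw [hpl]
    exact ⟨fun h3 => tendsto_nhds_unique h3 hsum, fun h3 => h3 ▸ hsum⟩
  constructor
  · rintro ⟨hm, ht⟩
    -- Finite distance to a single partial sum already puts `ghat` in L².
    obtain ⟨F, hF⟩ := (ht.eventually (gt_mem_nhds ENNReal.zero_lt_top)).exists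
    have h : MemLp ghat 2 (law H σ x₀) := by
      have h1 : MemLp (fun y => ghat y - partialSum d σ x₀ a F y) 2 (law H σ x₀) :=
        ⟨hm.sub (hpm F).1, hF⟩
      exact (memLp_congr_ae (ae_of_all _ fun y => sub_add_cancel _ _)).mp (h1.add (hpm F))
    exact ⟨h, (hlim h).mp ht⟩
  · rintro ⟨h, ht⟩
    exact ⟨h.1, (hlim h).mpr ht⟩

end Statistics

end SLGM

end

/-! ### The minimum variance and the LMV estimator. -/

theorem theorem6 {M N S : ℕ} (hS : 1 ≤ S) (hSN : S ≤ N)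
    (H : Matrix (Fin M) (Fin N) ℝ) (hH : (S : ℕ∞) < SLGM.spark H)
    (σ : ℝ) (hσ : 0 < σ) (d : SLGM.ThinSVD H)
    (g c : SLGM.sparseSet N S → ℝ) (x₀ : SLGM.sparseSet N S)
    (hc : SLGM.IsValid H σ S g c x₀) :
    -- the minimum achievable variance
    (∃ m : ℝ, IsLeast ((fun a => ‖a‖ ^ 2) '' SLGM.coeffSet d σ S g c x₀) m ∧
      (SLGM.minVariance H σ S g c x₀ : EReal) = ((m - (c x₀ + g x₀) ^ 2 : ℝ) : EReal)) ∧
    -- every consistent coefficient sequence yields an allowed estimator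
    (∀ a ∈ SLGM.coeffSet d σ S g c x₀,
      (∃ ghat, SLGM.IsSeriesEstimator d σ x₀ a ghat) ∧
      ∀ ghat, SLGM.IsSeriesEstimator d σ x₀ a ghat → ghat ∈ SLGM.allowed H σ S g c x₀) ∧
    -- the LMV estimator is the one of the unique consistent sequence of minimum norm
    (∃ a₀ ∈ SLGM.coeffSet d σ S g c x₀,
      (∀ a ∈ SLGM.coeffSet d σ S g c x₀, ‖a₀‖ ≤ ‖a‖) ∧
      (∀ a ∈ SLGM.coeffSet d σ S g c x₀,
        (∀ b ∈ SLGM.coeffSet d σ S g c x₀, ‖a‖ ≤ ‖b‖) → a = a₀) ∧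
      ∀ ghat, SLGM.IsLMV H σ S g c x₀ ghat ↔ SLGM.IsSeriesEstimator d σ x₀ a₀ ghat) := by
  set e := SLGM.orthonormal_basisVec hσ d (x₀ : Fin N → ℝ) with he
  have hP := SLGM.isProbabilityMeasure_law H hσ x₀
  -- the estimators of consistent sequences are allowed
  have hseries : ∀ a ∈ SLGM.coeffSet d σ S g c x₀, ∀ ghat,
      SLGM.IsSeriesEstimator d σ x₀ a ghat → ghat ∈ SLGM.allowed H σ S g c x₀ := by
    intro a ha ghat hg
    obtain ⟨h, hT⟩ := (SLGM.isSeriesEstimator_iff hσ d x₀ a ghat).mp hg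
    refine (SLGM.mem_allowed_iff g c x₀ hσ d ghat).mpr ⟨h, fun x => ?_⟩
    rw [hT, ← SLGM.inner_coeffs]
    exact (SLGM.mem_coeffSet_iff g c x₀ hσ d a).mp ha x
  have hexists : ∀ a : SLGM.ell2 H.rank, ∃ ghat, SLGM.IsSeriesEstimator d σ x₀ a ghat := by
    intro a
    exact ⟨_, (SLGM.isSeriesEstimator_iff hσ d x₀ a _).mpr
      ⟨Lp.memLp (SLGM.synth e a), Lp.toLp_coeFn _ _⟩⟩
  -- the coefficients of allowed estimators are consistent
  have hcoeffs : ∀ ghat (h : MemLp ghat 2 (SLGM.law H σ x₀)),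
      ghat ∈ SLGM.allowed H σ S g c x₀ →
      SLGM.coeffs e (h.toLp ghat) ∈ SLGM.coeffSet d σ S g c x₀ := by
    intro ghat h hg
    obtain ⟨_, hx⟩ := (SLGM.mem_allowed_iff g c x₀ hσ d ghat).mp hg
    refine (SLGM.mem_coeffSet_iff g c x₀ hσ d _).mpr fun x => ?_
    -- Discarding the part of `ghat` outside the closed span changes no mean, since the likelihood
    -- ratios lie in that span.
    rw [real_inner_comm, SLGM.inner_coeffs, SLGM.synth_coeffs_ratioVec, real_inner_comm]
    exact hx x
  have hmem : ∀ ghat ∈ SLGM.allowed H σ S g c x₀, MemLp ghat 2 (SLGM.law H σ x₀) :=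
    fun ghat hg => ((SLGM.mem_allowed_iff g c x₀ hσ d ghat).mp hg).1
  obtain ⟨g₁, hg₁⟩ := hc
  obtain ⟨a₀, ha₀, hmin⟩ := SLGM.exists_minimal_solution
    (fun x : SLGM.sparseSet N S => SLGM.coeffs e (SLGM.ratioVec hσ d x₀ x)) (fun x => c x + g x)
    ((SLGM.mem_coeffSet_iff g c x₀ hσ d _).mp (hcoeffs g₁ (hmem g₁ hg₁) hg₁))
  replace ha₀ := (SLGM.mem_coeffSet_iff g c x₀ hσ d a₀).mpr ha₀
  replace hmin : ∀ a ∈ SLGM.coeffSet d σ S g c x₀, ‖a‖ ^ 2 = ‖a₀‖ ^ 2 + ‖a - a₀‖ ^ 2 :=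
    fun a ha => hmin a ((SLGM.mem_coeffSet_iff g c x₀ hσ d a).mp ha)
  have hle : ∀ a ∈ SLGM.coeffSet d σ S g c x₀, ‖a₀‖ ≤ ‖a‖ := fun a ha => by
    have := hmin a ha
    exact (abs_le_of_sq_le_sq' (by nlinarith [sq_nonneg ‖a - a₀‖]) (norm_nonneg a)).2
  have huniq : ∀ a ∈ SLGM.coeffSet d σ S g c x₀, ‖a‖ ≤ ‖a₀‖ → a = a₀ := fun a ha h => by
    have h1 := hmin a ha
    rw [le_antisymm h (hle a ha)] at h1
    have : ‖a - a₀‖ ^ 2 = 0 := by linarith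
    exact sub_eq_zero.mp (norm_eq_zero.mp (pow_eq_zero_iff two_ne_zero |>.mp this))
  have hnorm : ∀ ghat (h : MemLp ghat 2 (SLGM.law H σ x₀)),
      ghat ∈ SLGM.allowed H σ S g c x₀ → ‖a₀‖ ≤ ‖h.toLp ghat‖ := fun ghat h hg =>
    (hle _ (hcoeffs ghat h hg)).trans (SLGM.norm_coeffs_le e _)
  have hvar0 : ∀ ghat, SLGM.IsSeriesEstimator d σ x₀ a₀ ghat →
      SLGM.variance H σ ghat x₀ = ENNReal.ofReal (‖a₀‖ ^ 2 - (c x₀ + g x₀) ^ 2) := by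
    intro ghat hg
    obtain ⟨h, hT⟩ := (SLGM.isSeriesEstimator_iff hσ d x₀ a₀ ghat).mp hg
    rw [SLGM.variance_eq_of_mem_allowed g c x₀ hσ (hseries a₀ ha₀ ghat hg) h, hT,
      (SLGM.synth _).norm_map]
  -- `ENNReal.ofReal` truncates negative values; this number is a genuine variance, so nothing is
  -- lost.
  have hnonneg : 0 ≤ ‖a₀‖ ^ 2 - (c x₀ + g x₀) ^ 2 := by
    obtain ⟨ghat, hg⟩ := hexists a₀
    have hal := hseries a₀ ha₀ ghat hg
    obtain ⟨h, hT⟩ := (SLGM.isSeriesEstimator_iff hσ d x₀ a₀ ghat).mp hg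
    have h1 := ProbabilityTheory.variance_nonneg ghat (SLGM.law H σ x₀)
    rw [ProbabilityTheory.variance_eq_sub h] at h1
    have h2 : ‖a₀‖ ^ 2 = ∫ y, ghat y ^ 2 ∂(SLGM.law H σ x₀) := by
      rw [← (SLGM.synth e).norm_map a₀, ← hT, ← real_inner_self_eq_norm_sq, SLGM.inner_toLp]
      simp_rw [sq]
    rw [h2, ← (hal.2 x₀).2, sub_add_cancel]
    simpa using! h1
  have hminVar : SLGM.minVariance H σ S g c x₀ =
      ENNReal.ofReal (‖a₀‖ ^ 2 - (c x₀ + g x₀) ^ 2) := by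
    refine le_antisymm ?_ (le_iInf₂ fun ghat hg => ?_)
    · obtain ⟨ghat, hg⟩ := hexists a₀
      rw [← hvar0 ghat hg]
      exact iInf₂_le _ (hseries a₀ ha₀ ghat hg)
    · rw [SLGM.variance_eq_of_mem_allowed g c x₀ hσ hg (hmem ghat hg)]
      have := hnorm ghat (hmem ghat hg) hg
      gcongr
  refine ⟨⟨‖a₀‖ ^ 2, ⟨⟨a₀, ha₀, rfl⟩, ?_⟩, ?_⟩, fun a ha => ⟨hexists a, hseries a ha⟩,
    a₀, ha₀, hle, fun a ha h => huniq a ha (h a₀ ha₀), fun ghat => ⟨fun hg => ?_, fun hg => ?_⟩⟩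
  · rintro _ ⟨a, ha, rfl⟩
    have := hle a ha
    simp only
    gcongr
  · rw [hminVar, EReal.coe_ennreal_ofReal, max_eq_left hnonneg]
  · obtain ⟨hal, hv⟩ := hg
    have h := hmem ghat hal
    rw [hminVar, SLGM.variance_eq_of_mem_allowed g c x₀ hσ hal h] at hv
    have hn : ‖h.toLp ghat‖ ≤ ‖a₀‖ := by
      have h1 := (ENNReal.ofReal_le_ofReal_iff hnonneg).mp hv.le
      exact (abs_le_of_sq_le_sq' (by linarith) (norm_nonneg a₀)).2
    have ha := hcoeffs ghat h hal
    -- An LMV estimator has coefficients of least norm, hence `a₀`; equality in Bessel's inequality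
    -- then makes it the synthesis of `a₀`.
    have h2 := huniq _ ha ((SLGM.norm_coeffs_le e _).trans hn)
    refine (SLGM.isSeriesEstimator_iff hσ d x₀ a₀ ghat).mpr ⟨h, ?_⟩
    rw [← h2, SLGM.synth_coeffs_of_norm_le]
    rw [h2]
    exact hn
  · exact ⟨hseries a₀ ha₀ ghat hg, (hvar0 ghat hg).trans hminVar.symm⟩
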